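/- Let $K$ be an algebraically closed field, let $p_1,\dots,p_r\in\mathbb{P}^2_K$ with $0\le r\le 3$ be points in general position (distinct, and not collinear if $r=3$), and let $d,m_1,\dots,m_r\ge 0$ be integers. Let $\mathcal L=\mathcal L(d,m_1,\dots,m_r)$ be the linear system of plane curves of degree $d$ with multiplicity at least $m_i$ at $p_i$ for every $i$, let $l(\mathcal L)$ be its projective dimension (with $l=-1$ if it is empty), and let $$v(\mathcal L)=\frac{d(d+3)}{2}-\sum_{i=1}^r\frac{m_i(m_i+1)}{2},\qquad e(\mathcal L)=\max\{v(\mathcal L),-1\}.$$ The system $\mathcal L$ is called special if $l(\mathcal L)>e(\mathcal L)$. Let $S$ be the blow-up of $\mathbb{P}^2$ at $p_1,\dots,p_r$, with canonical class $K_S$, with $H$ the pull-back of a line and $E_1,\dots,E_r$ the exceptional curves, and identify $\mathcal L$ with the class $dH-\sum_i m_iE_i$. The virtual dimension of an arbitrary class $d'H-\sum_i m_i'E_i$, $d',m_i'\in\mathbb{Z}$, is given by the same formula. A $(-1)$-curve on $S$ is an irreducible curve $C$ with $C^2=C\cdot K_S=-1$. The system $\mathcal L$ is called $(-1)$-special if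 there are distinct $(-1)$-curves $C_1,\dots,C_s$ on $S$ such that $\mathcal L\cdot C_j=-n_j$ with $n_j\ge 1$ for every $j$ and $n_j\ge 2$ for some $j$, and such that the residual system $\mathcal M=\mathcal L-\sum_j n_jC_j$ has degree $\mathcal M\cdot H\ge 0$ and virtual dimension $v(\mathcal M)\ge 0$. Then $\mathcal L$ is special if and only if it is $(-1)$-special. -/

import Mathlib

namespace PlaneSystems

open MvPolynomial

/-- The projective plane over `K`, with homogeneous coordinates indexed by `Fin 3`. -/
abbrev Plane (K : Type*) [Field K] : Type _ := Projectivization K (Fin 3 → K)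

/-- The homogeneous ideal of a point of the plane: it is generated by the linear forms that
vanish at the point. -/
noncomputable def pointIdeal {K : Type*} [Field K] (p : Plane K) : Ideal (MvPolynomial (Fin 3) K) :=
  Ideal.span {l | l.IsHomogeneous 1 ∧ eval p.rep l = 0}

/-- The form `F` vanishes at `p` with multiplicity at least `m`. -/
def MultAtLeast {K : Type*} [Field K] (p : Plane K) (m : ℕ) (F : MvPolynomial (Fin 3) K) : Prop :=
  F ∈ pointIdeal p ^ m

/-- The form `F` has multiplicity exactly `m` at `p`. -/
def HasMult {K : Type*} [Field K] (p : Plane K) (m : ℕ) (F : MvPolynomial (Fin 3) K) : Prop :=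
  MultAtLeast p m F ∧ ¬ MultAtLeast p (m + 1) F

/-- The vector space of forms of degree `d` with multiplicity at least `m i` at `p i`. The linear
system `L(d, m₁, …, m_r)` of plane curves is its projectivization. -/
noncomputable def system {K : Type*} [Field K] {r : ℕ} (p : Fin r → Plane K) (d : ℕ) (m : Fin r → ℕ) :
    Submodule K (MvPolynomial (Fin 3) K) :=
  homogeneousSubmodule (Fin 3) K d ⊓
    ⨅ i, (pointIdeal (p i) ^ m i).restrictScalars K

/-- The effective (projective) dimension of the linear system; it is `-1` for an empty system. -/
noncomputable def effectiveDim {K : Type*} [Field K] {r : ℕ} (p : Fin r → Plane K) (d : ℕ)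
    (m : Fin r → ℕ) : ℤ :=
  (Module.finrank K (system p d m) : ℤ) - 1

/-- The Picard group of the blow-up `S` of the plane at `r` distinct points: the pair `(d, m)`
is the class `d H - ∑ i, m i • E_i`, where `H` is the pull-back of a line and the `E_i` are the
exceptional curves. -/
abbrev DivClass (r : ℕ) : Type := ℤ × (Fin r → ℤ)

/-- The intersection product: `H² = 1`, `E_i² = -1`, and all other products are `0`. -/
def inter {r : ℕ} (D D' : DivClass r) : ℤ := D.1 * D'.1 - ∑ i, D.2 i * D'.2 i

/-- The canonical class `K_S = -3 H + ∑ i, E_i`. -/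
def canonicalClass (r : ℕ) : DivClass r := (-3, fun _ => -1)

/-- The virtual dimension `d (d + 3) / 2 - ∑ i, m_i (m_i + 1) / 2`. All the divisions are exact,
and the value is `(D² - D · K_S) / 2`. -/
def virtualDim {r : ℕ} (D : DivClass r) : ℤ :=
  D.1 * (D.1 + 3) / 2 - ∑ i, D.2 i * (D.2 i + 1) / 2

/-- The expected dimension. -/
def expectedDim {r : ℕ} (D : DivClass r) : ℤ := max (virtualDim D) (-1)

/-- The class on the blow-up of the system of curves of degree `d` with multiplicities `m i`. -/
def systemClass {r : ℕ} (d : ℕ) (m : Fin r → ℕ) : DivClass r := ((d : ℤ), fun i => (m i : ℤ))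

/-- The linear system is special if its effective dimension exceeds the expected one. -/
def IsSpecial {K : Type*} [Field K] {r : ℕ} (p : Fin r → Plane K) (d : ℕ) (m : Fin r → ℕ) : Prop :=
  expectedDim (systemClass d m) < effectiveDim p d m

/-- `E` is the class of an irreducible curve on the blow-up at the points `p i`. Such a curve is
either an exceptional curve, or the strict transform of an irreducible plane curve `F = 0`, whose
class records the degree of `F` and its multiplicities at the points. -/
inductive IsIrreducibleCurveClass {K : Type*} [Field K] {r : ℕ} (p : Fin r → Plane K) :
    DivClass r → Prop
  | exceptional (i : Fin r) : IsIrreducibleCurveClass p (0, -Pi.single i 1)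
  | strictTransform (F : MvPolynomial (Fin 3) K) (hF : Irreducible F) (e : ℕ)
      (he : F.IsHomogeneous e) (k : Fin r → ℕ) (hk : ∀ i, HasMult (p i) (k i) F) :
      IsIrreducibleCurveClass p (systemClass e k)

/-- `E` is the class of a `(-1)`-curve: an irreducible curve with `E² = E · K_S = -1`. Distinct
irreducible curves have non-negative intersection, so a `(-1)`-curve is determined by its class. -/
def IsNegOneCurve {K : Type*} [Field K] {r : ℕ} (p : Fin r → Plane K) (E : DivClass r) : Prop :=
  IsIrreducibleCurveClass p E ∧ inter E E = -1 ∧ inter E (canonicalClass r) = -1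

/-- The residual class `L - ∑ n_E E` with `n_E = -(L · E)`, where `E` runs through `C`. -/
def residual {r : ℕ} (L : DivClass r) (C : Finset (DivClass r)) : DivClass r :=
  L - ∑ E ∈ C, (-inter L E) • E

/-- `L` is `(-1)`-special: there are finitely many distinct `(-1)`-curves `E` with
`L · E = -n_E`, all `n_E ≥ 1` and some `n_E ≥ 2`, such that the residual system is a system of
curves of degree at least `0` and has virtual dimension at least `0`. -/
def IsNegOneSpecial {K : Type*} [Field K] {r : ℕ} (p : Fin r → Plane K) (L : DivClass r) : Prop :=
  ∃ C : Finset (DivClass r),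
    (∀ E ∈ C, IsNegOneCurve p E) ∧
    (∀ E ∈ C, 1 ≤ -inter L E) ∧
    (∃ E ∈ C, 2 ≤ -inter L E) ∧
    0 ≤ (residual L C).1 ∧
    0 ≤ virtualDim (residual L C)

end PlaneSystems

/-! At most three independent points can be moved to coordinate points. A form of degree `d` then
has multiplicity at least `m i` at `p i` exactly when each of its monomials has `i`-th exponent at
most `d - m i`, so `l(L) + 1` counts lattice points in a triangle with truncated corners
(`finrank_system`). Put `n_ij = max (m i + m j - d) 0`. If `m i ≤ d` for all `i` and `∑ m i ≤ 2 d`,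
inclusion-exclusion gives `2 l(L) = 2 v(L) + ∑_{i<j} n_ij (n_ij - 1)` (`two_mul_effectiveDim`). The
only (-1)-curves that can meet `L` negatively are the lines through two of the points. They are
pairwise disjoint on `S`, so removing one `n` times, where `L` meets it in `-n`, raises `v` by `n (n
- 1) / 2` (`two_mul_virtualDim_residual`). The correction to `l` is therefore what removing the
lines adds to `v`. If `L` is special it is nonempty, the inequalities hold, and removing all lines
with `n_ij ≥ 1` gives `v(M) = l(L) ≥ 0`. Conversely, `v(M) ≥ 0` in degree `≥ 0` forces the
inequalities for `M`, hence for `L`, and then `l(L) ≥ v(M) ≥ 0` and `l(L) > v(L)`. -/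

namespace PlaneSystems

open MvPolynomial

/-! ### Monomial ideals and linear changes of coordinates -/

section Algebra

/-- Membership in a power of an ideal generated by variables is read off from the exponents. -/
theorem mem_span_X_image_pow {σ R : Type*} [CommRing R] (t : Finset σ)
    (n : ℕ) (F : MvPolynomial σ R) :
    F ∈ Ideal.span ((X : σ → MvPolynomial σ R) '' (t : Set σ)) ^ n ↔
      ∀ s ∈ F.support, n ≤ ∑ j ∈ t, s j := by
  classical
  constructor
  -- The exponent condition is closed upward, so it defines an ideal `J k`; it contains the `k`-th
  -- power because weights add under multiplication.
  · let J : ℕ → Ideal (MvPolynomial σ R) := fun k =>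
      restrictSupportIdeal R {s | k ≤ ∑ j ∈ t, s j}
        (fun a b hab ha => le_trans ha (Finset.sum_le_sum fun j _ => hab j))
    have key : ∀ k, Ideal.span ((X : σ → MvPolynomial σ R) '' (t : Set σ)) ^ k ≤ J k := by
      intro k
      induction k with
      | zero => exact fun F _ s _ => Nat.zero_le _
      | succ k ih =>
        rw [pow_succ, Ideal.mul_le]
        intro f hf g hg s hs
        obtain ⟨a, ha, b, hb, rfl⟩ := Finset.mem_add.1 (support_mul f g hs)
        have h1 : k ≤ ∑ j ∈ t, a j := ih hf ha
        obtain ⟨j, hj, hbj⟩ := mem_ideal_span_X_image.1 hg b hb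
        have h2 : b j ≤ ∑ j ∈ t, b j := Finset.single_le_sum (f := fun j => b j)
          (fun _ _ => Nat.zero_le _) (Finset.mem_coe.1 hj)
        change k + 1 ≤ ∑ j ∈ t, (a + b) j
        simp only [Finsupp.add_apply, Finset.sum_add_distrib]
        omega
    exact fun hF s hs => key n hF hs
  · have mono : ∀ k (s : σ →₀ ℕ) (c : R), k ≤ ∑ j ∈ t, s j →
        monomial s c ∈ Ideal.span ((X : σ → MvPolynomial σ R) '' (t : Set σ)) ^ k := by
      intro k
      induction k with
      | zero => simp
      | succ k ih =>
        intro s c hs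
        obtain ⟨j, hj, hne⟩ : ∃ j ∈ t, s j ≠ 0 := by
          by_contra! h
          rw [Finset.sum_eq_zero h] at hs
          omega
        have hle : Finsupp.single j 1 ≤ s := by simpa using Nat.one_le_iff_ne_zero.2 hne
        obtain ⟨u, rfl⟩ := exists_add_of_le hle
        have hu : k ≤ ∑ j ∈ t, u j := by
          simp only [Finsupp.add_apply, Finset.sum_add_distrib, Finsupp.single_apply,
            Finset.sum_ite_eq, hj, if_true] at hs
          omega
        have : monomial (Finsupp.single j 1 + u) c = monomial u c * X j := by
          rw [X, monomial_mul, mul_one, add_comm]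
        rw [this, pow_succ]
        exact Ideal.mul_mem_mul (ih u c hu) (Ideal.subset_span ⟨j, hj, rfl⟩)
    intro h
    rw [F.as_sum]
    exact Ideal.sum_mem _ fun s hs => mono n s _ (h s hs)

/-- The linear forms vanishing at a coordinate point generate the ideal of the other variables. -/
theorem span_linearForms_vanishing_single {σ K : Type*} [Field K] [Fintype σ] [DecidableEq σ]
    (i : σ) :
    Ideal.span {l : MvPolynomial σ K | l.IsHomogeneous 1 ∧ eval (Pi.single i 1) l = 0} =
      Ideal.span (X '' ((Finset.univ.erase i : Finset σ) : Set σ)) := by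
  apply le_antisymm
  · rw [Ideal.span_le]
    rintro l ⟨hl, h0⟩
    have hl' := (mem_homogeneousSubmodule 1 l).2 hl
    rw [homogeneousSubmodule_one_eq_span_X] at hl'
    obtain ⟨c, rfl⟩ := (Submodule.mem_span_range_iff_exists_fun K).1 hl'
    have hc : c i = 0 := by
      simpa [map_sum, smul_eval, Pi.single_apply] using h0
    refine Ideal.sum_mem _ fun k _ => ?_
    rcases eq_or_ne k i with rfl | hk
    · simp [hc]
    · rw [smul_eq_C_mul]
      exact Ideal.mul_mem_left _ _ (Ideal.subset_span ⟨k, by simpa using hk, rfl⟩)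
  · rw [Ideal.span_le]
    rintro _ ⟨j, hj, rfl⟩
    refine Ideal.subset_span ⟨isHomogeneous_X _ _, ?_⟩
    have : j ≠ i := by simpa using hj
    simp [this]

/-- In dimension `n`, an independent family indexed by `Fin r` extends to one indexed by `Fin n`. -/
theorem exists_linearIndependent_extension {K V : Type*} [Field K] [AddCommGroup V] [Module K V]
    {n : ℕ} (hn : Module.finrank K V = n) :
    ∀ (k r : ℕ) (hr : r + k = n) (v : Fin r → V), LinearIndependent K v →
      ∃ b : Fin n → V, LinearIndependent K b ∧ ∀ i, b (Fin.castLE (by omega) i) = v i := by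
  intro k
  induction k with
  | zero =>
    rintro r rfl v hv
    exact ⟨v, hv, fun i => rfl⟩
  | succ k ih =>
    intro r hr v hv
    obtain ⟨x, hx⟩ := exists_linearIndependent_snoc_of_lt_finrank hv (by omega)
    obtain ⟨b, hb, hbv⟩ := ih (r + 1) (by omega) _ hx
    refine ⟨b, hb, fun i => ?_⟩
    have := hbv i.castSucc
    rw [Fin.snoc_castSucc] at this
    exact this

/-- A linear change of coordinates that moves the coordinate points to a given basis. -/
theorem exists_coordinateChange {K σ : Type*} [Field K] [Fintype σ] [DecidableEq σ]
    (b : σ → σ → K) (hb : LinearIndependent K b) :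
    ∃ φ : MvPolynomial σ K ≃ₐ[K] MvPolynomial σ K,
      (∀ F n, (φ F).IsHomogeneous n ↔ F.IsHomogeneous n) ∧
      (∀ i F, eval (b i) (φ F) = eval (Pi.single i 1) F) := by
  let B : Matrix σ σ K := Matrix.of b
  have hB : IsUnit B := Matrix.linearIndependent_rows_iff_isUnit.1 hb
  have hdet : IsUnit B.det := (Matrix.isUnit_iff_isUnit_det B).1 hB
  have h1 : B * B⁻¹ = 1 := Matrix.mul_nonsing_inv _ hdet
  have h2 : B⁻¹ * B = 1 := Matrix.nonsing_inv_mul _ hdet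
  let f : Matrix σ σ K → MvPolynomial σ K →ₐ[K] MvPolynomial σ K := fun A =>
    aeval fun j => ∑ k, C (A k j) * X k
  have hf : ∀ A A' : Matrix σ σ K, A' * A = 1 → (f A').comp (f A) = AlgHom.id K _ := by
    intro A A' h
    ext1 j
    simp only [f, AlgHom.comp_apply, aeval_X, map_sum, map_mul, AlgHom.id_apply, algHom_C,
      Finset.mul_sum, algebraMap_eq]
    rw [Finset.sum_comm]
    have : ∀ k, ∑ x, C (A x j) * (C (A' k x) * X k) = C ((1 : Matrix σ σ K) k j) * X k := by
      intro k
      rw [← h, Matrix.mul_apply, map_sum, Finset.sum_mul]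
      refine Finset.sum_congr rfl fun x _ => ?_
      rw [map_mul]; ring
    rw [Finset.sum_congr rfl fun k _ => this k]
    simp [Matrix.one_apply]
  have hom : ∀ A F n, F.IsHomogeneous n → (f A F).IsHomogeneous n := by
    intro A F n hF
    have := hF.aeval (fun j => ∑ k, C (A k j) * X k) (n := 1)
      fun j => IsHomogeneous.sum _ _ _ fun k _ => isHomogeneous_C_mul_X _ _
    rwa [one_mul] at this
  -- The substitution uses `B⁻¹` because the row `b i` times `B⁻¹` is the `i`-th unit vector.
  let φ := AlgEquiv.ofAlgHom (f B⁻¹) (f B) (hf _ _ h2) (hf _ _ h1)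
  refine ⟨φ, fun F n => ⟨fun h => ?_, fun h => hom _ _ _ h⟩, fun i F => ?_⟩
  · have := hom B _ _ h
    rwa [show f B (φ F) = F from φ.symm_apply_apply F] at this
  · have : ((aeval (b i) : MvPolynomial σ K →ₐ[K] K).comp (f B⁻¹)) =
        aeval (Pi.single i 1 : σ → K) := by
      ext j
      have hij : ∑ k, b i k * B⁻¹ k j = (1 : Matrix σ σ K) i j := by
        rw [← h1, Matrix.mul_apply]; rfl
      simp only [f, AlgHom.comp_apply, aeval_X, map_sum, map_mul, algHom_C, Algebra.algebraMap_self,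
        RingHom.id_apply]
      rw [← Finset.sum_congr rfl fun k _ => mul_comm (b i k) (B⁻¹ k j), hij, Matrix.one_apply,
        Pi.single_apply]
      simp [eq_comm]
    have := DFunLike.congr_fun this F
    simp only [AlgHom.comp_apply, aeval_eq_eval] at this
    exact this

end Algebra

/-! ### Linear systems and lines in adapted coordinates -/

section Coordinates

/-- In suitable coordinates the points `p i` are coordinate points, so that the multiplicities
of a form can be read off from its exponents. -/
theorem exists_adapted_coordinates {K : Type*} [Field K] {r : ℕ} (hr : r ≤ 3) (p : Fin r → Plane K)
    (hp : Projectivization.Independent p) :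
    ∃ φ : MvPolynomial (Fin 3) K ≃ₐ[K] MvPolynomial (Fin 3) K,
      (∀ F n, (φ F).IsHomogeneous n ↔ F.IsHomogeneous n) ∧
      ∀ i n F, MultAtLeast (p i) n (φ F) ↔
        ∀ s ∈ F.support, n ≤ ∑ j ∈ Finset.univ.erase (Fin.castLE hr i), s j := by
  obtain ⟨b, hb, hbp⟩ := exists_linearIndependent_extension (K := K) (V := Fin 3 → K) (n := 3)
    (by simp) (3 - r) r (by omega) _ (Projectivization.independent_iff.1 hp)
  obtain ⟨φ, hom, hev⟩ := exists_coordinateChange b hb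
  refine ⟨φ, hom, fun i n F => ?_⟩
  rw [← mem_span_X_image_pow, ← span_linearForms_vanishing_single]
  have hpt : pointIdeal (p i) = Ideal.map φ (Ideal.span
      {l | l.IsHomogeneous 1 ∧ eval (Pi.single (Fin.castLE hr i) 1) l = 0}) := by
    rw [Ideal.map_span, pointIdeal]
    congr 1
    ext l
    have hrep : (p i).rep = b (Fin.castLE hr i) := (hbp i).symm
    rw [hrep]
    constructor
    · rintro ⟨h1, h2⟩
      refine ⟨φ.symm l, ⟨?_, ?_⟩, φ.apply_symm_apply l⟩
      · rwa [← hom, φ.apply_symm_apply]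
      · rwa [← hev, φ.apply_symm_apply]
    · rintro ⟨l, ⟨h1, h2⟩, rfl⟩
      exact ⟨(hom _ _).2 h1, (hev _ _).trans h2⟩
  rw [MultAtLeast, hpt, ← Ideal.map_pow]
  constructor
  · intro h
    obtain ⟨G, hG, hGF⟩ := (Ideal.mem_map_iff_of_surjective φ φ.surjective).1 h
    rwa [← φ.injective hGF]
  · exact fun h => Ideal.mem_map_of_mem _ h

/-- The multiplicities, extended by zero to all three coordinate points. -/
def extendMult {r : ℕ} (m : Fin r → ℕ) (k : Fin 3) : ℕ := if h : k.1 < r then m ⟨k, h⟩ else 0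

/-- The exponents of the monomials of degree `d` whose `k`-th exponent is at most `d - m k`. -/
def exponentSet (d : ℕ) (m : Fin 3 → ℕ) : Set (Fin 3 →₀ ℕ) :=
  {s | s 0 + s 1 + s 2 = d ∧ ∀ k, s k + m k ≤ d}

/-- In degree `d` the exponents other than the `k`-th add up to `d - s k`, so multiplicity at least
`m k` becomes `s k + m k ≤ d`. A padded multiplicity `0` imposes nothing. -/
theorem finrank_system {K : Type*} [Field K] {r : ℕ} (hr : r ≤ 3) (p : Fin r → Plane K)
    (hp : Projectivization.Independent p) (d : ℕ) (m : Fin r → ℕ) :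
    Module.finrank K (system p d m) = (exponentSet d (extendMult m)).ncard := by
  obtain ⟨φ, hom, hmult⟩ := exists_adapted_coordinates hr p hp
  have : system p d m = (restrictSupport K (exponentSet d (extendMult m))).map
      (φ.toLinearEquiv : MvPolynomial (Fin 3) K →ₗ[K] MvPolynomial (Fin 3) K) := by
    ext G
    obtain ⟨F, rfl⟩ := φ.surjective G
    have hR : φ F ∈ (restrictSupport K (exponentSet d (extendMult m))).map
        (φ.toLinearEquiv : MvPolynomial (Fin 3) K →ₗ[K] MvPolynomial (Fin 3) K) ↔
        F ∈ restrictSupport K (exponentSet d (extendMult m)) := by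
      constructor
      · rintro ⟨F', hF', h⟩
        rwa [← φ.injective h]
      · exact fun h => ⟨F, h, rfl⟩
    rw [hR, mem_restrictSupport_iff, system]
    simp only [Submodule.mem_inf, Submodule.mem_iInf, Submodule.restrictScalars_mem,
      mem_homogeneousSubmodule, hom]
    have hsum : ∀ s : Fin 3 →₀ ℕ, ∀ i, s i + ∑ j ∈ Finset.univ.erase i, s j = s 0 + s 1 + s 2 := by
      intro s i
      rw [Finset.add_sum_erase _ _ (Finset.mem_univ i), Fin.sum_univ_three]
    have hdeg : ∀ s : Fin 3 →₀ ℕ, s.degree = s 0 + s 1 + s 2 := by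
      intro s
      rw [Finsupp.degree_eq_sum, Fin.sum_univ_three]
    constructor
    · rintro ⟨h1, h2⟩ s hs
      have hd := (hdeg s).symm.trans (h1.degree_eq_sum_deg_support hs).symm
      refine ⟨hd, fun k => ?_⟩
      have := hsum s k
      unfold extendMult
      split_ifs with hk
      · have h3 := (hmult ⟨k, hk⟩ _ F).1 (h2 _) s hs
        simp only [Fin.castLE_mk, Fin.eta] at h3
        omega
      · omega
    · intro h
      refine ⟨?_, fun i => (hmult i _ F).2 fun s hs => ?_⟩
      · intro s hs
        have := (h (mem_support_iff.2 hs)).1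
        rw [← hdeg s] at this
        rw [← this, Finsupp.degree_eq_weight_one]
        rfl
      · have h1 := (h hs).1
        have h2 := (h hs).2 (Fin.castLE hr i)
        have := hsum s (Fin.castLE hr i)
        simp only [extendMult, Fin.val_castLE, Fin.is_lt, dite_true, Fin.eta] at h2
        omega
  rw [this, LinearEquiv.finrank_map_eq, Module.finrank_eq_nat_card_basis (basisRestrictSupport K _),
    Nat.card_coe_set_eq]

/-- The class of the strict transform of the line through the `i`-th and the `j`-th point. -/
def lineClass {r : ℕ} (i j : Fin r) : DivClass r := (1, Pi.single i 1 + Pi.single j 1)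

/-- The line through two coordinate points is cut out by the remaining variable, which is prime and
does not vanish at the third coordinate point. -/
theorem isIrreducibleCurveClass_lineClass {K : Type*} [Field K] {r : ℕ} (hr : r ≤ 3)
    (p : Fin r → Plane K) (hp : Projectivization.Independent p) {i j : Fin r} (hij : i ≠ j) :
    IsIrreducibleCurveClass p (lineClass i j) := by
  obtain ⟨φ, hom, hmult⟩ := exists_adapted_coordinates hr p hp
  obtain ⟨k, hk⟩ : ∃ k : Fin 3, ∀ l : Fin r, Fin.castLE hr l ≠ k ↔ l = i ∨ l = j := by
    have : ∀ a b : Fin 3, a ≠ b → ∃ k : Fin 3, ∀ l, l ≠ k ↔ l = a ∨ l = b := by decide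
    obtain ⟨k, hk⟩ := this (Fin.castLE hr i) (Fin.castLE hr j) (by simpa using hij)
    exact ⟨k, fun l => by simp [hk]⟩
  have hX : Irreducible (X k : MvPolynomial (Fin 3) K) := (X_prime (i := k)).irreducible
  have := IsIrreducibleCurveClass.strictTransform (p := p) (φ (X k))
    ((MulEquiv.irreducible_iff φ).2 hX) 1 ((hom _ _).2 (isHomogeneous_X _ _))
    (fun l => if Fin.castLE hr l = k then 0 else 1) (by
      intro l
      rw [HasMult, hmult, hmult]
      simp only [support_X, Finset.mem_singleton, forall_eq, Finsupp.single_apply,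
        Finset.sum_ite_eq, Finset.mem_erase, Finset.mem_univ, and_true]
      by_cases h : Fin.castLE hr l = k
      · simp [h]
      · simp [h, Ne.symm h])
  convert this using 1
  rw [lineClass, systemClass]
  ext l
  · simp
  · have hl := hk l
    by_cases h1 : l = i
    · subst h1
      have h2 : Fin.castLE hr l ≠ k := hl.2 (Or.inl rfl)
      simp [h2, hij]
    · by_cases h3 : l = j
      · subst h3
        have h2 : Fin.castLE hr l ≠ k := hl.2 (Or.inr rfl)
        simp [h2, h1]
      · have h2 : Fin.castLE hr l = k := by
          by_contra h
          exact (hl.1 h).elim h1 h3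
        simp [h2, h1, h3]

end Coordinates

/-! ### Lattice points in a triangle with truncated corners -/

section Counting

/-- The lattice points `(x, y, z)` with `x + y + z = d`, `x ≤ d - a`, `y ≤ d - b`, `z ≤ d - c`. -/
def latticePoints (d a b c : ℕ) : Finset (ℕ × ℕ × ℕ) :=
  {q ∈ Finset.range (d + 1) ×ˢ Finset.range (d + 1) ×ˢ Finset.range (d + 1) |
    q.1 + q.2.1 + q.2.2 = d ∧ q.1 + a ≤ d ∧ q.2.1 + b ≤ d ∧ q.2.2 + c ≤ d}

theorem mem_latticePoints {d a b c x y z : ℕ} :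
    (x, y, z) ∈ latticePoints d a b c ↔ x + y + z = d ∧ x + a ≤ d ∧ y + b ≤ d ∧ z + c ≤ d := by
  simp only [latticePoints, Finset.mem_filter, Finset.mem_product, Finset.mem_range]
  omega

theorem ncard_exponentSet (d : ℕ) (m : Fin 3 → ℕ) :
    (exponentSet d m).ncard = (latticePoints d (m 0) (m 1) (m 2)).card := by
  rw [← Set.ncard_coe_finset]
  refine Set.ncard_congr (fun s _ => (s 0, s 1, s 2)) ?_ ?_ ?_
  · rintro s ⟨h1, h2⟩
    exact mem_latticePoints.2 ⟨h1, h2 0, h2 1, h2 2⟩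
  · intro s t _ _ h
    simp only [Prod.mk.injEq] at h
    ext k
    fin_cases k
    exacts [h.1, h.2.1, h.2.2]
  · rintro ⟨x, y, z⟩ h
    obtain ⟨h1, h2, h3, h4⟩ := mem_latticePoints.1 h
    refine ⟨Finsupp.equivFunOnFinite.symm ![x, y, z], ⟨by simpa using h1, ?_⟩, by simp⟩
    intro k
    fin_cases k
    exacts [by simpa using h2, by simpa using h3, by simpa using h4]

theorem card_latticePoints_swap_left (d a b c : ℕ) :
    (latticePoints d a b c).card = (latticePoints d b a c).card := by
  refine Finset.card_nbij' (fun q => (q.2.1, q.1, q.2.2)) (fun q => (q.2.1, q.1, q.2.2)) ?_ ?_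
    (fun _ _ => rfl) (fun _ _ => rfl) <;>
  · rintro ⟨x, y, z⟩ h
    have := mem_latticePoints.1 h
    exact mem_latticePoints.2 (by dsimp only; omega)

theorem card_latticePoints_swap_right (d a b c : ℕ) :
    (latticePoints d a b c).card = (latticePoints d a c b).card := by
  refine Finset.card_nbij' (fun q => (q.1, q.2.2, q.2.1)) (fun q => (q.1, q.2.2, q.2.1)) ?_ ?_
    (fun _ _ => rfl) (fun _ _ => rfl) <;>
  · rintro ⟨x, y, z⟩ h
    have := mem_latticePoints.1 h
    exact mem_latticePoints.2 (by dsimp only; omega)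

/-- Imposing one more condition at the third vertex removes the points of a segment. -/
theorem card_latticePoints_succ {d a b c : ℕ} (ha : a ≤ d) (hb : b ≤ d) (hc : c ≤ d)
    (h : a + b + c ≤ 2 * d + 1) :
    (latticePoints d a b c).card + (a + c - d) + (b + c - d) =
      (latticePoints d a b (c + 1)).card + (c + 1) := by
  -- The points lost have `z = d - c`, so `y = c - x`, and the bounds on `x` and `y` leave an
  -- interval for `x`. The bound `2 * d + 1` allows this interval to be empty, but no shorter than
  -- the formula can express.
  have hsplit : latticePoints d a b c = latticePoints d a b (c + 1) ∪
      (Finset.Icc (b + c - d) (min c (d - a))).image fun x => (x, c - x, d - c) := by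
    ext ⟨x, y, z⟩
    simp only [Finset.mem_union, mem_latticePoints, Finset.mem_image, Finset.mem_Icc,
      Prod.mk.injEq]
    constructor
    · intro h1
      by_cases hz : z + c = d
      · exact Or.inr ⟨x, by omega, rfl, by omega, by omega⟩
      · exact Or.inl (by omega)
    · rintro (h1 | ⟨x', h1, rfl, rfl, rfl⟩) <;> omega
  have hdisj : Disjoint (latticePoints d a b (c + 1))
      ((Finset.Icc (b + c - d) (min c (d - a))).image fun x => (x, c - x, d - c)) := by
    rw [Finset.disjoint_left]
    rintro ⟨x, y, z⟩ h1 h2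
    simp only [mem_latticePoints, Finset.mem_image, Finset.mem_Icc, Prod.mk.injEq] at h1 h2
    obtain ⟨x', h2, rfl, rfl, rfl⟩ := h2
    omega
  rw [hsplit, Finset.card_union_of_disjoint hdisj, Finset.card_image_of_injective _
    (fun x y hxy => (Prod.mk.inj hxy).1), Nat.card_Icc]
  omega

/-- The increment of `k * (k - 1)` is `2 * k`, and truncation at `d` preserves this. It matches the
correction terms with the segment removed at each step. -/
theorem excess_succ (n d : ℕ) :
    (n + 1 - d) * (n + 1 - d - 1) = (n - d) * (n - d - 1) + 2 * (n - d) := by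
  rcases lt_or_ge n d with h | h
  · have h1 : n + 1 - d - 1 = 0 := by omega
    have h2 : n - d = 0 := by omega
    simp [h1, h2]
  · obtain ⟨k, rfl⟩ := exists_add_of_le h
    have h1 : d + k + 1 - d = k + 1 := by omega
    rw [h1, Nat.add_sub_cancel_left, Nat.add_sub_cancel]
    cases k with
    | zero => rfl
    | succ k => rw [Nat.add_sub_cancel]; ring

/-- Descending induction on `c` from the empty set at `c = d + 1`; the full triangle appears at the
end, as `c = 0`. -/
theorem two_mul_card_latticePoints_zero_zero (d : ℕ) : ∀ k c : ℕ, c + k = d + 1 →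
    2 * (latticePoints d 0 0 c).card + c * (c + 1) = (d + 1) * (d + 2) := by
  intro k
  induction k with
  | zero =>
    rintro c hc
    have : latticePoints d 0 0 c = ∅ := by
      rw [Finset.eq_empty_iff_forall_notMem]
      rintro ⟨x, y, z⟩ h
      have := mem_latticePoints.1 h
      omega
    rw [this, show c = d + 1 by omega]
    simp
  | succ k ih =>
    intro c hc
    have h1 := ih (c + 1) (by omega)
    have h2 := card_latticePoints_succ (d := d) (a := 0) (b := 0) (c := c) (by omega) (by omega)
      (by omega) (by omega)
    have h3 : 0 + c - d = 0 := by omega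
    rw [h3] at h2
    linarith

/-- Ascending induction on `c` from `h0`, the formula at `c = 0`: the segment removed has `c + 1 -
(a + c - d) - (b + c - d)` points. -/
theorem two_mul_card_latticePoints_of_zero {d a b : ℕ} (ha : a ≤ d) (hb : b ≤ d)
    (h0 : 2 * (latticePoints d a b 0).card + (a * (a + 1) + b * (b + 1)) =
      (d + 1) * (d + 2) + (a + b - d) * (a + b - d - 1)) :
    ∀ c, c ≤ d → a + b + c ≤ 2 * d →
      2 * (latticePoints d a b c).card + (a * (a + 1) + b * (b + 1) + c * (c + 1)) =
        (d + 1) * (d + 2) + ((a + b - d) * (a + b - d - 1) + (a + c - d) * (a + c - d - 1) +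
          (b + c - d) * (b + c - d - 1)) := by
  intro c
  induction c with
  | zero =>
    intro _ _
    have h1 : a + 0 - d = 0 := by omega
    have h2 : b + 0 - d = 0 := by omega
    rw [h1, h2]
    linarith
  | succ c ih =>
    intro hc hs
    have h1 := ih (by omega) (by omega)
    have h2 := card_latticePoints_succ ha hb (by omega : c ≤ d) (by omega)
    have h3 := excess_succ (a + c) d
    have h4 := excess_succ (b + c) d
    rw [← add_assoc a, ← add_assoc b, h3, h4]
    linarith

/-- The number of lattice points, by inclusion and exclusion over the three corners. -/
theorem two_mul_card_latticePoints {d a b c : ℕ} (ha : a ≤ d) (hb : b ≤ d) (hc : c ≤ d)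
    (h : a + b + c ≤ 2 * d) :
    2 * (latticePoints d a b c).card + (a * (a + 1) + b * (b + 1) + c * (c + 1)) =
      (d + 1) * (d + 2) + ((a + b - d) * (a + b - d - 1) + (a + c - d) * (a + c - d - 1) +
        (b + c - d) * (b + c - d - 1)) := by
  refine two_mul_card_latticePoints_of_zero ha hb ?_ c hc h
  -- The corners are cut one at a time, first `a`, then `b`, then `c`; the swaps bring the corner
  -- being cut to the third place.
  have h1 := two_mul_card_latticePoints_zero_zero d (d + 1 - a) a (by omega)
  rw [← card_latticePoints_swap_right, card_latticePoints_swap_left] at h1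
  have hz : a - d = 0 := by omega
  have h2 := two_mul_card_latticePoints_of_zero (d := d) (a := a) (b := 0) ha (by omega)
    (by simp only [add_zero, zero_mul, hz]; linarith) b hb (by omega)
  have hz' : 0 + b - d = 0 := by omega
  rw [card_latticePoints_swap_right]
  simp only [hz', add_zero, zero_mul, hz] at h2
  linarith

/-- A nonempty count thus lies in the range where the counting formula holds. -/
theorem card_latticePoints_pos {d a b c : ℕ} (h : 0 < (latticePoints d a b c).card) :
    a ≤ d ∧ b ≤ d ∧ c ≤ d ∧ a + b + c ≤ 2 * d := by
  obtain ⟨⟨x, y, z⟩, hq⟩ := Finset.card_pos.1 h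
  have := mem_latticePoints.1 hq
  omega

end Counting

/-! ### Intersection theory and (-1)-curves on the blow-up -/

section Classes

variable {r : ℕ}

theorem inter_comm (D D' : DivClass r) : inter D D' = inter D' D := by
  simp only [inter, mul_comm]

theorem inter_add_left (D₁ D₂ D' : DivClass r) :
    inter (D₁ + D₂) D' = inter D₁ D' + inter D₂ D' := by
  simp only [inter, Prod.fst_add, Prod.snd_add, Pi.add_apply, add_mul, Finset.sum_add_distrib]
  ring

theorem inter_smul_left (n : ℤ) (D D' : DivClass r) : inter (n • D) D' = n * inter D D' := by
  simp only [inter, Prod.smul_fst, Prod.smul_snd, Pi.smul_apply, smul_eq_mul, mul_assoc,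
    ← Finset.mul_sum]
  ring

theorem inter_sum_left {ι : Type*} (s : Finset ι) (f : ι → DivClass r) (D : DivClass r) :
    inter (∑ i ∈ s, f i) D = ∑ i ∈ s, inter (f i) D :=
  map_sum (AddMonoidHom.mk' (fun D' => inter D' D) fun a b => inter_add_left a b D) f s

theorem two_mul_virtualDim (D : DivClass r) :
    2 * virtualDim D = D.1 * (D.1 + 3) - ∑ i, D.2 i * (D.2 i + 1) := by
  have h : ∀ x : ℤ, 2 * (x * (x + 1) / 2) = x * (x + 1) := fun x =>
    Int.mul_ediv_cancel' (even_iff_two_dvd.1 (Int.even_mul_succ_self x))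
  have h' : ∀ x : ℤ, 2 * (x * (x + 3) / 2) = x * (x + 3) := by
    intro x
    refine Int.mul_ediv_cancel' ?_
    have := even_iff_two_dvd.1 (Int.even_mul_succ_self x)
    rw [show x * (x + 3) = x * (x + 1) + 2 * x by ring]
    exact dvd_add this (dvd_mul_right _ _)
  rw [virtualDim, mul_sub, h', Finset.mul_sum]
  simp only [h]

theorem two_mul_virtualDim_eq_inter (D : DivClass r) :
    2 * virtualDim D = inter D D - inter D (canonicalClass r) := by
  rw [two_mul_virtualDim, inter, inter, canonicalClass]
  simp only [mul_add, Finset.sum_add_distrib, mul_neg, mul_one, Finset.sum_neg_distrib]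
  ring

/-- Removing disjoint `(-1)`-curves `E` with `L · E = -n` raises the virtual dimension by
`n (n - 1) / 2` each. -/
theorem two_mul_virtualDim_residual (L : DivClass r) (C : Finset (DivClass r))
    (hself : ∀ E ∈ C, inter E E = -1) (hcan : ∀ E ∈ C, inter E (canonicalClass r) = -1)
    (horth : ∀ E ∈ C, ∀ E' ∈ C, E ≠ E' → inter E E' = 0) :
    2 * virtualDim (residual L C) =
      2 * virtualDim L + ∑ E ∈ C, (-inter L E) * (-inter L E - 1) := by
  set R : DivClass r := ∑ E ∈ C, (-inter L E) • E with hR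
  have hRD : ∀ D, inter R D = ∑ E ∈ C, (-inter L E) * inter E D := by
    intro D
    rw [hR, inter_sum_left]
    simp only [inter_smul_left]
  -- By disjointness and `E² = -1`, `R` meets each `E` as `L` does, so `R · R` collapses to the same
  -- sum as `R · L`.
  have hRE : ∀ E ∈ C, inter R E = inter L E := by
    intro E hE
    rw [hRD, Finset.sum_eq_single E]
    · rw [hself E hE]; ring
    · intro E' hE' hne
      rw [horth E' hE' E hE hne, mul_zero]
    · exact fun h => absurd hE h
  have hRR : inter R R = ∑ E ∈ C, (-inter L E) * inter L E := by
    rw [hRD]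
    refine Finset.sum_congr rfl fun E hE => ?_
    rw [inter_comm E R, hRE E hE]
  have hRL : inter R L = ∑ E ∈ C, (-inter L E) * inter L E := by
    rw [hRD]
    exact Finset.sum_congr rfl fun E hE => by rw [inter_comm E L]
  have hRK : inter R (canonicalClass r) = ∑ E ∈ C, inter L E := by
    rw [hRD]
    exact Finset.sum_congr rfl fun E hE => by rw [hcan E hE]; ring
  have hM : residual L C = L + (-1 : ℤ) • R := by
    rw [residual, neg_one_smul, sub_eq_add_neg]
  rw [two_mul_virtualDim_eq_inter, two_mul_virtualDim_eq_inter, hM]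
  simp only [inter_add_left, inter_comm _ (L + _), inter_smul_left, inter_comm L ((-1 : ℤ) • R),
    inter_comm R ((-1 : ℤ) • R)]
  rw [hRR, hRL, hRK]
  have : ∑ E ∈ C, (-inter L E) * (-inter L E - 1) =
      ∑ E ∈ C, inter L E - ∑ E ∈ C, (-inter L E) * inter L E := by
    rw [← Finset.sum_sub_distrib]
    exact Finset.sum_congr rfl fun E _ => by ring
  rw [this]
  ring

/-- A class of non-negative degree and virtual dimension meets the pencils of lines through a
point and the conics through the points non-negatively. -/
theorem le_degree_of_virtualDim_nonneg (hr : r ≤ 3) {D : DivClass r} (hd : 0 ≤ D.1)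
    (hv : 0 ≤ virtualDim D) : (∀ i, D.2 i ≤ D.1) ∧ ∑ i, D.2 i ≤ 2 * D.1 := by
  have h2 := two_mul_virtualDim D
  have hnn : ∀ x : ℤ, 0 ≤ x * (x + 1) := by
    intro x
    rcases le_or_gt 0 x with h | h
    · positivity
    · exact mul_nonneg_of_nonpos_of_nonpos h.le (by omega)
  constructor
  · intro i
    have h3 : D.2 i * (D.2 i + 1) ≤ ∑ i, D.2 i * (D.2 i + 1) :=
      Finset.single_le_sum (f := fun i => D.2 i * (D.2 i + 1)) (fun i _ => hnn _)
        (Finset.mem_univ i)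
    -- Otherwise one term is at least `(D.1 + 1) (D.1 + 2) = D.1 (D.1 + 3) + 2`, which makes
    -- `virtualDim D` negative.
    by_contra! h
    nlinarith
  · have hcs := sq_sum_le_card_mul_sum_sq (s := Finset.univ) (f := fun i => D.2 i)
    rw [Finset.card_univ, Fintype.card_fin] at hcs
    have hsq : ∑ i, D.2 i * (D.2 i + 1) = ∑ i, D.2 i ^ 2 + ∑ i, D.2 i := by
      rw [← Finset.sum_add_distrib]
      exact Finset.sum_congr rfl fun i _ => by ring
    have h0 : 0 ≤ ∑ i, D.2 i ^ 2 := Finset.sum_nonneg fun i _ => sq_nonneg _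
    have hr' : (r : ℤ) ≤ 3 := by exact_mod_cast hr
    have h3 : (∑ i, D.2 i) ^ 2 ≤ 3 * ∑ i, D.2 i ^ 2 :=
      hcs.trans (mul_le_mul_of_nonneg_right hr' h0)
    -- With `∑ D.2 i ≥ 2 D.1 + 1`, Cauchy-Schwarz for at most three terms makes `∑ D.2 i (D.2 i +
    -- 1)` exceed `D.1 (D.1 + 3)`.
    by_contra! h
    nlinarith

theorem inter_lineClass (L : DivClass r) (i j : Fin r) :
    inter L (lineClass i j) = L.1 - L.2 i - L.2 j := by
  simp only [inter, lineClass, Pi.add_apply, mul_add, Finset.sum_add_distrib, mul_one,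
    Pi.single_apply, mul_ite, mul_zero, Finset.sum_ite_eq', Finset.mem_univ, if_true]
  ring

/-- The pairs of indices `i < j`, which label the lines through two of the points. -/
def linePairs (r : ℕ) : Finset (Fin r × Fin r) := {q | q.1 < q.2}

theorem lineClass_injOn :
    Set.InjOn (fun q : Fin r × Fin r => lineClass q.1 q.2) (linePairs r : Set (Fin r × Fin r)) := by
  rintro ⟨i, j⟩ hij ⟨k, l⟩ hkl h
  simp only [linePairs, Finset.coe_filter, Finset.mem_univ, true_and, Set.mem_ofPred_eq] at hij hkl
  have h1 := congrFun (congrArg Prod.snd h) i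
  have h2 := congrFun (congrArg Prod.snd h) j
  have h3 := congrFun (congrArg Prod.snd h) k
  simp only [lineClass, Pi.add_apply, Pi.single_apply] at h1 h2 h3
  simp only [Prod.mk.injEq]
  grind

/-- Distinct pairs among at most three indices share exactly one, so the product is `1 - 1`: the
lines meet only at a blown-up point. -/
theorem inter_lineClass_lineClass (hr : r ≤ 3) :
    ∀ q ∈ linePairs r, ∀ q' ∈ linePairs r, q ≠ q' →
      inter (lineClass q.1 q.2) (lineClass q'.1 q'.2) = 0 := by
  interval_cases r <;> decide

theorem inter_lineClass_self {i j : Fin r} (hij : i ≠ j) :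
    inter (lineClass i j) (lineClass i j) = -1 := by
  rw [inter_lineClass]
  simp [lineClass, hij, hij.symm]

theorem inter_lineClass_canonicalClass (i j : Fin r) :
    inter (lineClass i j) (canonicalClass r) = -1 := by
  rw [inter_comm, inter_lineClass]
  simp [canonicalClass]

/-- A class of plane curves with the numerical invariants of a `(-1)`-curve is a line through two
of at most three points. -/
theorem exists_eq_lineClass (hr : r ≤ 3) (e : ℕ) (k : Fin r → ℕ)
    (h1 : inter (systemClass e k) (systemClass e k) = -1)
    (h2 : inter (systemClass e k) (canonicalClass r) = -1) :
    ∃ q ∈ linePairs r, systemClass e k = lineClass q.1 q.2 := by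
  simp only [inter, systemClass, canonicalClass, mul_neg, mul_one, Finset.sum_neg_distrib] at h1 h2
  have hcs := sq_sum_le_card_mul_sum_sq (s := Finset.univ) (f := fun i => (k i : ℤ))
  rw [Finset.card_univ, Fintype.card_fin] at hcs
  have hr' : (r : ℤ) ≤ 3 := by exact_mod_cast hr
  have h0 : 0 ≤ ∑ i, (k i : ℤ) ^ 2 := Finset.sum_nonneg fun i _ => sq_nonneg _
  have h3 := hcs.trans (mul_le_mul_of_nonneg_right hr' h0)
  have hs : ∑ i, (k i : ℤ) = 3 * e - 1 := by linarith
  have hq : ∑ i, (k i : ℤ) ^ 2 = e * e + 1 := by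
    simp only [sq]; linarith
  have hsnn : 0 ≤ ∑ i, (k i : ℤ) := Finset.sum_nonneg fun i _ => by positivity
  -- Cauchy-Schwarz reads `(3 e - 1)² ≤ 3 (e² + 1)`, which excludes `e ≥ 2`; for `e = 0` the
  -- multiplicities would sum to `-1`.
  obtain rfl : e = 1 := by
    rw [hs, hq] at h3
    have : (e : ℤ) ≤ 1 := by
      by_contra! h
      nlinarith
    omega
  have hle : ∀ i, k i ≤ 1 := by
    intro i
    have := Finset.single_le_sum (f := fun i => (k i : ℤ) ^ 2) (fun i _ => sq_nonneg _)
      (Finset.mem_univ i)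
    simp only [hq] at this
    have : (k i : ℤ) ≤ 1 := by
      by_contra! h
      push_cast at this
      nlinarith
    exact_mod_cast this
  have hs' : ∑ i, k i = 2 := by
    have : ∑ i, (k i : ℤ) = 2 := by rw [hs]; norm_num
    exact_mod_cast this
  have hcard : (Finset.univ.filter fun i => k i = 1).card = 2 := by
    rw [Finset.card_filter, ← hs']
    refine Finset.sum_congr rfl fun i _ => ?_
    have := hle i
    split_ifs <;> omega
  obtain ⟨i, j, hij, hset⟩ := Finset.card_eq_two.1 hcard
  have hk : ∀ l, k l = 1 ↔ l = i ∨ l = j := by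
    intro l
    have : l ∈ Finset.univ.filter (fun i => k i = 1) ↔ l ∈ ({i, j} : Finset (Fin r)) := by
      rw [hset]
    simpa using this
  have hkl : ∀ a b, a ≠ b → (∀ l, k l = 1 ↔ l = a ∨ l = b) →
      systemClass 1 k = lineClass a b := by
    intro a b hab hk
    rw [systemClass, lineClass]
    ext l
    · simp
    · have h5 := hk l
      have h6 := hle l
      simp only [Pi.add_apply, Pi.single_apply]
      grind
  rcases lt_or_gt_of_ne hij with h | h
  · exact ⟨(i, j), by simpa [linePairs] using h, hkl i j hij hk⟩
  · exact ⟨(j, i), by simpa [linePairs] using h, hkl j i hij.symm fun l => by rw [hk, or_comm]⟩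

/-- An exceptional curve `E_i` has `L · E_i = m i ≥ 0`, so `hneg` leaves only strict transforms. -/
theorem IsNegOneCurve.exists_eq_lineClass {K : Type*} [Field K] (hr : r ≤ 3) {p : Fin r → Plane K}
    {E : DivClass r} (hE : IsNegOneCurve p E) {d : ℕ} {m : Fin r → ℕ}
    (hneg : 1 ≤ -inter (systemClass d m) E) :
    ∃ q ∈ linePairs r, E = lineClass q.1 q.2 := by
  obtain ⟨hirr, h1, h2⟩ := hE
  cases hirr with
  | exceptional i =>
    exfalso
    simp [inter, systemClass, Pi.single_apply] at hneg
    omega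
  | strictTransform F hF e he k hk => exact PlaneSystems.exists_eq_lineClass hr e k h1 h2

theorem isNegOneCurve_lineClass {K : Type*} [Field K] (hr : r ≤ 3) {p : Fin r → Plane K}
    (hp : Projectivization.Independent p) {i j : Fin r} (hij : i ≠ j) :
    IsNegOneCurve p (lineClass i j) :=
  ⟨isIrreducibleCurveClass_lineClass hr p hp hij, inter_lineClass_self hij,
    inter_lineClass_canonicalClass i j⟩

end Classes

/-! ### Comparison of the two notions of speciality -/

section Main

variable {r : ℕ}

/-- The excess `max (m i + m j - d) 0` along the line through the `i`-th and `j`-th point. -/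
def lineExcess (d : ℕ) (m : Fin r → ℕ) (q : Fin r × Fin r) : ℤ :=
  max (-inter (systemClass d m) (lineClass q.1 q.2)) 0

theorem lineExcess_eq_cast (d : ℕ) (m : Fin r → ℕ) (q : Fin r × Fin r) :
    lineExcess d m q = ((m q.1 + m q.2 - d : ℕ) : ℤ) := by
  rw [lineExcess, inter_lineClass]
  simp only [systemClass]
  omega

/-- This is the point count, with `(d + 1) (d + 2) - 2 = d (d + 3)` absorbing the `-1` of the
projective dimension. Padding to three points adds only pairs of zero excess, since `m i ≤ d`. -/
theorem two_mul_effectiveDim {K : Type*} [Field K] (hr : r ≤ 3) {p : Fin r → Plane K}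
    (hp : Projectivization.Independent p) {d : ℕ} {m : Fin r → ℕ} (hd : ∀ i, m i ≤ d)
    (hs : ∑ i, m i ≤ 2 * d) :
    2 * effectiveDim p d m = 2 * virtualDim (systemClass d m) +
      ∑ q ∈ linePairs r, lineExcess d m q * (lineExcess d m q - 1) := by
  have hg : ∀ n : ℕ, ((n * (n - 1) : ℕ) : ℤ) = n * ((n : ℤ) - 1) := by
    intro n
    cases n <;> simp
  have hsum : ∑ k, extendMult m k = ∑ i, m i ∧ ∑ k, (extendMult m k : ℤ) * (extendMult m k + 1) =
      ∑ i, (m i : ℤ) * (m i + 1) := by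
    interval_cases r <;> simp [extendMult, Fin.sum_univ_succ]
  have hle : ∀ k, extendMult m k ≤ d := by
    intro k
    unfold extendMult
    split_ifs
    exacts [hd _, Nat.zero_le _]
  have hcount := two_mul_card_latticePoints (hle 0) (hle 1) (hle 2)
    (by rw [← Fin.sum_univ_three, hsum.1]; exact hs)
  have hpairs : ∑ q ∈ linePairs r, lineExcess d m q * (lineExcess d m q - 1) =
      ∑ q ∈ linePairs 3, lineExcess d (extendMult m) q * (lineExcess d (extendMult m) q - 1) := by
    simp only [lineExcess_eq_cast, linePairs, Finset.sum_filter, Fintype.sum_prod_type]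
    have hz : ∀ i, m i - d = 0 := fun i => Nat.sub_eq_zero_of_le (hd i)
    interval_cases r <;> simp [extendMult, Fin.sum_univ_succ, hz]
  rw [hpairs, effectiveDim, finrank_system hr p hp, ncard_exponentSet, two_mul_virtualDim]
  have h3 : ∑ q ∈ linePairs 3, lineExcess d (extendMult m) q * (lineExcess d (extendMult m) q - 1) =
      ∑ q ∈ ({(0, 1), (0, 2), (1, 2)} : Finset (Fin 3 × Fin 3)),
        lineExcess d (extendMult m) q * (lineExcess d (extendMult m) q - 1) := by
    congr 1
  rw [h3, Finset.sum_insert (by decide), Finset.sum_insert (by decide), Finset.sum_singleton]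
  simp only [lineExcess_eq_cast, ← hg]
  have h4 := hsum.2
  rw [Fin.sum_univ_three] at h4
  simp only [systemClass]
  rw [← h4]
  have hcount' := congrArg (Nat.cast : ℕ → ℤ) hcount
  simp only [Nat.cast_add, Nat.cast_mul _ (_ + _), Nat.cast_mul 2, Nat.cast_one,
    Nat.cast_ofNat] at hcount'
  linarith

theorem le_degree_of_effectiveDim_nonneg {K : Type*} [Field K] (hr : r ≤ 3) {p : Fin r → Plane K}
    (hp : Projectivization.Independent p) {d : ℕ} {m : Fin r → ℕ} (h : 0 ≤ effectiveDim p d m) :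
    (∀ i, m i ≤ d) ∧ ∑ i, m i ≤ 2 * d := by
  rw [effectiveDim, finrank_system hr p hp, ncard_exponentSet] at h
  obtain ⟨h0, h1, h2, hs⟩ := card_latticePoints_pos
    (Nat.pos_of_ne_zero fun h' => by rw [h'] at h; omega)
  constructor
  · intro i
    have : ∀ k, extendMult m k ≤ d := by
      intro k
      fin_cases k
      exacts [h0, h1, h2]
    simpa [extendMult] using this (Fin.castLE hr i)
  · rw [← Fin.sum_univ_three] at hs
    convert hs using 1
    interval_cases r <;> simp [extendMult, Fin.sum_univ_succ]

theorem mul_sub_one_nonneg (x : ℤ) : 0 ≤ x * (x - 1) := by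
  rcases le_or_gt 1 x with h | h
  · exact mul_nonneg (by omega) (by omega)
  · exact mul_nonneg_of_nonpos_of_nonpos (by omega) (by omega)

/-- Removing the lines with positive excess leaves a class of non-negative degree. -/
theorem sum_lineExcess_le (hr : r ≤ 3) {d : ℕ} {m : Fin r → ℕ} (hd : ∀ i, m i ≤ d)
    (hs : ∑ i, m i ≤ 2 * d) : ∑ q ∈ linePairs r, lineExcess d m q ≤ d := by
  simp only [lineExcess_eq_cast, linePairs, Finset.sum_filter, Fintype.sum_prod_type]
  interval_cases r
  · simp
  · simp
  · have h0 := hd 0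
    have h1 := hd 1
    simp [Fin.sum_univ_succ]
    omega
  -- Three positive excesses sum to `2 ∑ m - 3 d ≤ d`; two sum to `∑ m + m i - 2 d ≤ m i`, with `i`
  -- the shared index; a single one is at most `2 d - d`.
  · have h0 := hd 0
    have h1 := hd 1
    have h2 := hd 2
    rw [Fin.sum_univ_three] at hs
    simp [Fin.sum_univ_three]
    omega

/-- The curves removed are all the lines of positive excess, so that `v(M) = l(L)`. Some excess is
at least `2`, since otherwise `l(L) = v(L)`. -/
theorem isNegOneSpecial_of_isSpecial {K : Type*} [Field K] (hr : r ≤ 3) {p : Fin r → Plane K}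
    (hp : Projectivization.Independent p) {d : ℕ} {m : Fin r → ℕ} (h : IsSpecial p d m) :
    IsNegOneSpecial p (systemClass d m) := by
  rw [IsSpecial, expectedDim, max_lt_iff] at h
  obtain ⟨hd, hs⟩ := le_degree_of_effectiveDim_nonneg (d := d) (m := m) hr hp (by omega)
  have hdim := two_mul_effectiveDim hr hp hd hs
  generalize hL : systemClass d m = L at h hdim ⊢
  obtain ⟨Q, hQ⟩ : ∃ Q, Q = (linePairs r).filter fun q => 1 ≤ -inter L (lineClass q.1 q.2) :=
    ⟨_, rfl⟩
  have hQmem : ∀ q ∈ Q, q ∈ linePairs r ∧ 1 ≤ -inter L (lineClass q.1 q.2) := by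
    intro q hq
    rwa [hQ, Finset.mem_filter] at hq
  have hQlt : ∀ q ∈ Q, q.1 ≠ q.2 := by
    intro q hq
    have := (Finset.mem_filter.1 (hQmem q hq).1).2
    exact this.ne
  have hinj : Set.InjOn (fun q : Fin r × Fin r => lineClass q.1 q.2) (Q : Set (Fin r × Fin r)) :=
    lineClass_injOn.mono fun q hq => (hQmem q hq).1
  obtain ⟨C, hC⟩ : ∃ C : Finset (DivClass r), C = Q.image fun q => lineClass q.1 q.2 := ⟨_, rfl⟩
  have hCmem : ∀ E ∈ C, ∃ q ∈ Q, lineClass q.1 q.2 = E := by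
    intro E hE
    rwa [hC, Finset.mem_image] at hE
  -- Lines of zero excess contribute `g 0 = 0`. The identity serves for the degree with `g n = n`
  -- and for the virtual dimension with `g n = n (n - 1)`.
  have hsumQ : ∀ g : ℤ → ℤ, g 0 = 0 → ∑ E ∈ C, g (-inter L E) =
      ∑ q ∈ linePairs r, g (lineExcess d m q) := by
    intro g hg
    rw [hC, Finset.sum_image hinj, hQ, Finset.sum_filter]
    refine Finset.sum_congr rfl fun q _ => ?_
    rw [lineExcess, hL]
    split_ifs with hq
    · rw [max_eq_left (by omega)]
    · rw [max_eq_right (by omega), hg]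
  have hmem : ∀ E ∈ C, IsNegOneCurve p E := by
    intro E hE
    obtain ⟨q, hq, rfl⟩ := hCmem _ hE
    exact isNegOneCurve_lineClass hr hp (hQlt q hq)
  refine ⟨C, hmem, ?_, ?_, ?_, ?_⟩
  · intro E hE
    obtain ⟨q, hq, rfl⟩ := hCmem _ hE
    exact (hQmem q hq).2
  · obtain ⟨q, hq, hpos⟩ : ∃ q ∈ linePairs r, 0 < lineExcess d m q * (lineExcess d m q - 1) := by
      by_contra! hcon
      have := Finset.sum_nonpos hcon
      omega
    have h2 : 2 ≤ -inter L (lineClass q.1 q.2) := by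
      by_contra! hlt
      have h0 : 0 ≤ lineExcess d m q := le_max_right _ _
      have h1 : lineExcess d m q ≤ 1 := by
        rw [lineExcess, hL]
        exact max_le (by omega) (by omega)
      nlinarith
    refine ⟨lineClass q.1 q.2, ?_, h2⟩
    rw [hC, hQ]
    exact Finset.mem_image.2 ⟨q, Finset.mem_filter.2 ⟨hq, by omega⟩, rfl⟩
  · have hdeg : (residual L C).1 =
        d - ∑ q ∈ linePairs r, lineExcess d m q := by
      have hid : ∑ E ∈ C, -inter L E = _ := hsumQ (fun n => n) rfl
      rw [← hid, residual, Prod.fst_sub, Prod.fst_sum, show L.1 = (d : ℤ) by rw [← hL]; rfl]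
      congr 1
      refine Finset.sum_congr rfl fun E hE => ?_
      obtain ⟨q, hq, rfl⟩ := hCmem _ hE
      simp [lineClass]
    rw [hdeg]
    have := sum_lineExcess_le hr hd hs
    omega
  · have := two_mul_virtualDim_residual L C
      (fun E hE => (hmem E hE).2.1) (fun E hE => (hmem E hE).2.2) (by
        intro E hE E' hE' hne
        obtain ⟨q, hq, rfl⟩ := hCmem _ hE
        obtain ⟨q', hq', rfl⟩ := hCmem _ hE'
        exact inter_lineClass_lineClass hr q (hQmem q hq).1 q'
          (hQmem q' hq').1 fun h => hne (by rw [h]))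
    rw [hsumQ (fun n => n * (n - 1)) (by simp)] at this
    omega

/-- The given curves may omit some lines of positive excess, so only `v(M) ≤ l(L)` is available, and
it suffices. -/
theorem isSpecial_of_isNegOneSpecial {K : Type*} [Field K] (hr : r ≤ 3) {p : Fin r → Plane K}
    (hp : Projectivization.Independent p) {d : ℕ} {m : Fin r → ℕ}
    (h : IsNegOneSpecial p (systemClass d m)) : IsSpecial p d m := by
  obtain ⟨C, hC, hone, ⟨E₀, hE₀, htwo⟩, hdeg, hvd⟩ := h
  have hline : ∀ E ∈ C, ∃ q ∈ linePairs r, E = lineClass q.1 q.2 := fun E hE =>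
    (hC E hE).exists_eq_lineClass hr (hone E hE)
  set L := systemClass d m with hL
  have hres := two_mul_virtualDim_residual L C
    (fun E hE => (hC E hE).2.1) (fun E hE => (hC E hE).2.2) (by
      intro E hE E' hE' hne
      obtain ⟨q, hq, rfl⟩ := hline E hE
      obtain ⟨q', hq', rfl⟩ := hline E' hE'
      exact inter_lineClass_lineClass hr q hq q' hq' fun h => hne (by rw [h]))
  obtain ⟨hMi, hMs⟩ := le_degree_of_virtualDim_nonneg hr hdeg hvd
  have hfst : (residual L C).1 = d - ∑ E ∈ C, -inter L E := by
    rw [residual, Prod.fst_sub, Prod.fst_sum]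
    congr 1
    refine Finset.sum_congr rfl fun E hE => ?_
    obtain ⟨q, hq, rfl⟩ := hline E hE
    simp [lineClass]
  have hsnd : ∀ i, (residual L C).2 i = m i - ∑ E ∈ C, -inter L E * E.2 i := by
    intro i
    rw [residual, Prod.snd_sub, Prod.snd_sum, Pi.sub_apply, Finset.sum_apply]
    rfl
  -- Restoring a line raises the degree by one and each multiplicity by at most one, so the
  -- inequality passes from `M` to `L`.
  have hd : ∀ i, m i ≤ d := by
    intro i
    have h1 := hMi i
    rw [hfst, hsnd] at h1
    have h2 : ∑ E ∈ C, -inter L E * E.2 i ≤ ∑ E ∈ C, -inter L E := by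
      refine Finset.sum_le_sum fun E hE => ?_
      have hE1 := hone E hE
      obtain ⟨q, hq, rfl⟩ := hline E hE
      have hlt : q.1 < q.2 := (Finset.mem_filter.1 hq).2
      have : (lineClass q.1 q.2).2 i ≤ 1 := by
        simp only [lineClass, Pi.add_apply, Pi.single_apply]
        grind
      nlinarith
    omega
  -- A restored line adds two to both sides.
  have hs : ∑ i, m i ≤ 2 * d := by
    rw [hfst, Finset.sum_congr rfl fun i _ => hsnd i, Finset.sum_sub_distrib,
      Finset.sum_comm] at hMs
    have h2 : ∑ E ∈ C, ∑ i, -inter L E * E.2 i = 2 * ∑ E ∈ C, -inter L E := by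
      rw [Finset.mul_sum]
      refine Finset.sum_congr rfl fun E hE => ?_
      obtain ⟨q, hq, rfl⟩ := hline E hE
      rw [← Finset.mul_sum]
      simp [lineClass, Finset.sum_add_distrib]
      ring
    rw [h2] at hMs
    zify
    linarith
  have hdim := two_mul_effectiveDim hr hp hd hs
  -- Omitted lines contribute `n (n - 1) ≥ 0`.
  have hle : ∑ E ∈ C, (-inter L E) * (-inter L E - 1) ≤
      ∑ q ∈ linePairs r, lineExcess d m q * (lineExcess d m q - 1) := by
    have hsub : C ⊆ (linePairs r).image fun q => lineClass q.1 q.2 := by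
      intro E hE
      obtain ⟨q, hq, rfl⟩ := hline E hE
      exact Finset.mem_image_of_mem _ hq
    calc ∑ E ∈ C, (-inter L E) * (-inter L E - 1)
        = ∑ E ∈ C, max (-inter L E) 0 * (max (-inter L E) 0 - 1) := by
          refine Finset.sum_congr rfl fun E hE => ?_
          have := hone E hE
          rw [max_eq_left (by omega)]
      _ ≤ ∑ E ∈ (linePairs r).image fun q => lineClass q.1 q.2,
            max (-inter L E) 0 * (max (-inter L E) 0 - 1) :=
          Finset.sum_le_sum_of_subset_of_nonneg hsub fun _ _ _ => mul_sub_one_nonneg _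
      _ = _ := by
          rw [Finset.sum_image lineClass_injOn]
          rfl
  have hpos : 0 < ∑ E ∈ C, (-inter L E) * (-inter L E - 1) :=
    Finset.sum_pos' (fun E _ => mul_sub_one_nonneg _)
      ⟨E₀, hE₀, mul_pos (by omega) (by omega)⟩
  rw [IsSpecial, expectedDim, max_lt_iff, ← hL]
  rw [← hL] at hdim
  omega

end Main

end PlaneSystems

theorem mainTheorem7 {K : Type*} [Field K] [IsAlgClosed K] (r : ℕ) (hr : r ≤ 3)
    (p : Fin r → PlaneSystems.Plane K) (hp : Projectivization.Independent p)
    (d : ℕ) (m : Fin r → ℕ) :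
    PlaneSystems.IsSpecial p d m ↔
      PlaneSystems.IsNegOneSpecial p (PlaneSystems.systemClass d m) :=
  ⟨PlaneSystems.isNegOneSpecial_of_isSpecial hr hp, PlaneSystems.isSpecial_of_isNegOneSpecial hr hp⟩
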